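/- Let $\mathcal A$ be a unital $C^*$-algebra (for instance a von Neumann algebra) and let $E$ be an $\mathcal A$-correspondence (for instance a $W^*$-correspondence): a right Hilbert $C^*$-module over $\mathcal A$ with $\mathcal A$-valued inner product linear in the first variable, and with a unital left action $\varphi$ of $\mathcal A$ by adjointable operators, $\varphi(a)^*=\varphi(a^*)$. Let $\sigma\colon\mathcal A\to\mathcal L(\mathcal E)$ be a nondegenerate $*$-representation on a Hilbert space $\mathcal E$. For a Hilbert space $\mathcal K$ with a nondegenerate representation $\pi$ of $\mathcal A$, let $E\otimes_{\mathcal A}\mathcal K$ be the Hilbert space completion of the span of the tensors $e\otimes h$ with $\langle e\otimes h,e'\otimes h'\rangle=\langle \pi(\langle e,e'\rangle)h,h'\rangle$ and left action $\varphi(a)\otimes I$; put $E^{\otimes 0}\otimes_\sigma\mathcal E=\mathcal E$ and $E^{\otimes n+1}\otimes_\sigma\mathcal E=E\otimes_{\mathcal A}(E^{\otimes n}\otimes_\sigma\mathcal E)$, and let $$\mathcal F^2(E,\sigma)=\bigoplus_{n\ge 0}E^{\otimes n}\otimes_\sigma\mathcal E .$$ Let $\mathcal F^\infty(E,\sigma)\subset\mathcal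 L(\mathcal F^2(E,\sigma))$ be the weak-$*$ closed algebra generated by the operators $\varphi_{\infty,\sigma}(a)=\operatorname{diag}(\sigma(a),\varphi(a)\otimes I,\varphi(a)\otimes I,\dots)$, $a\in\mathcal A$, and the creation operators $T_{\xi,\sigma}\colon(f_0,f_1,\dots)\mapsto(0,\xi\otimes f_0,\xi\otimes f_1,\dots)$, $\xi\in E$. Let $(E^\sigma)^*$ be the set of bounded operators $\eta\colon E\otimes_\sigma\mathcal E\to\mathcal E$ whose adjoint satisfies $\eta^*\sigma(a)=(\varphi(a)\otimes I)\eta^*$ for all $a\in\mathcal A$, and let $\mathbb D((E^\sigma)^*)=\{\eta\in(E^\sigma)^*:\|\eta\|<1\}$. For $\eta\in(E^\sigma)^*$ put $\eta^0=I_{\mathcal E}$ and $\eta^n=\eta(I_E\otimes\eta)\cdots(I_{E^{\otimes n-1}}\otimes\eta)\colon E^{\otimes n}\otimes_\sigma\mathcal E\to\mathcal E$. Let $\sigma(\mathcal A)'\subset\mathcal L(\mathcal E)$ be the commutant of $\sigma(\mathcal A)$. For $\eta\in\mathbb D((E^\sigma)^*)$, $b\in\sigma(\mathcal A)'$, $f=\oplus_n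 f_n\in\mathcal F^2(E,\sigma)$ and $R\in\mathcal F^\infty(E,\sigma)$ define $$f^\wedge(\eta,b)=\sum_{n=0}^\infty\eta^n(I_{E^{\otimes n}}\otimes b)f_n\in\mathcal E,\qquad R^\wedge(\eta)\in\mathcal L(\mathcal E),\quad R^\wedge(\eta)e=(Re)^\wedge(\eta,I_{\mathcal E}),$$ where $e\in\mathcal E$ is identified with $e\oplus0\oplus0\oplus\cdots\in\mathcal F^2(E,\sigma)$. **Proposition.** 1. If $R,S\in\mathcal F^\infty(E,\sigma)$, then $(RS)^\wedge(\eta)=R^\wedge(\eta)S^\wedge(\eta)$ for all $\eta\in\mathbb D((E^\sigma)^*)$. 2. If $R\in\mathcal F^\infty(E,\sigma)$ and $f\in\mathcal F^2(E,\sigma)$, then $(Rf)^\wedge(\eta,b)=R^\wedge(\eta)\,f^\wedge(\eta,b)$ for all $\eta\in\mathbb D((E^\sigma)^*)$ and $b\in\sigma(\mathcal A)'$. -/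

import Mathlib

open scoped TensorProduct Topology

universe u v

noncomputable section

set_option linter.unusedSectionVars false

namespace Toeplitz

/-- An `A`-correspondence over a (unital) C⋆-algebra `A`: a right Hilbert C⋆-module `E` over `A`
(the right action `e · a` is `MulOpposite.op a • e`), complete for the norm `‖⟨e, e⟩‖ ^ (1/2)`, with
an additional left action of `A` by adjointable operators.  The `A`-valued inner product `ip` is
linear in the first variable.  (Mathlib's `CStarModule` is not used because there the algebra acts
on the left, linearly for the inner product.) -/
class Correspondence (A : Type v) (E : Type u) [CStarAlgebra A] [PartialOrder A]
    [NormedAddCommGroup E] [NormedSpace ℂ E] [CompleteSpace E] [Module A E]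
    [Module Aᵐᵒᵖ E] where
  /-- The `A`-valued inner product `⟨e, f⟩`. -/
  ip : E → E → A
  ip_add_left : ∀ e f g : E, ip (e + f) g = ip e g + ip f g
  ip_smul_left : ∀ (c : ℂ) (e f : E), ip (c • e) f = c • ip e f
  ip_op_smul_left : ∀ (a : A) (e f : E), ip (MulOpposite.op a • e) f = ip e f * a
  star_ip : ∀ e f : E, star (ip e f) = ip f e
  ip_self_nonneg : ∀ e : E, 0 ≤ ip e e
  norm_sq_eq : ∀ e : E, ‖e‖ ^ 2 = ‖ip e e‖
  /-- Left multiplication by `a` is adjointable with adjoint left multiplication by `a⋆`. -/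
  ip_smul_left_eq : ∀ (a : A) (e f : E), ip (a • e) f = ip e (star a • f)
  /-- `(a · e) · b = a · (e · b)`. -/
  smul_op_smul : ∀ (a b : A) (e : E), MulOpposite.op b • (a • e) = a • (MulOpposite.op b • e)
  smul_complex : ∀ (c : ℂ) (a : A) (e : E), (c • a) • e = c • (a • e)
  op_smul_complex : ∀ (c : ℂ) (a : A) (e : E),
    MulOpposite.op (c • a) • e = c • (MulOpposite.op a • e)

/-- A Hilbert space with a nondegenerate (i.e. unital, as `A` is unital) `⋆`-representation of `A`,
in other words an `(A, ℂ)`-correspondence. -/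
structure HilbRep (A : Type v) [CStarAlgebra A] where
  /-- The underlying Hilbert space. -/
  carrier : Type u
  [normed : NormedAddCommGroup carrier]
  [inner : InnerProductSpace ℂ carrier]
  [complete : CompleteSpace carrier]
  /-- The representation of `A`. -/
  rep : A →⋆ₐ[ℂ] (carrier →L[ℂ] carrier)

attribute [instance] HilbRep.normed HilbRep.inner HilbRep.complete

theorem exists_jordan {B : Type*} [CStarAlgebra B] (G : B) (hG : IsSelfAdjoint G) :
    ∃ C D : B, star C * C - star D * D = G ∧ (star C * C) * (star D * D) = 0 := by
  let _ : PartialOrder B := CStarAlgebra.spectralOrder B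
  have _ : StarOrderedRing B := CStarAlgebra.spectralOrderedRing B
  obtain ⟨C, hC⟩ := CStarAlgebra.nonneg_iff_eq_star_mul_self.mp (CFC.posPart_nonneg G)
  obtain ⟨D, hD⟩ := CStarAlgebra.nonneg_iff_eq_star_mul_self.mp (CFC.negPart_nonneg G)
  exact ⟨C, D, by rw [← hC, ← hD]; exact CFC.posPart_sub_negPart G hG,
    by rw [← hC, ← hD]; exact CFC.posPart_mul_negPart G⟩

variable {A : Type v} [CStarAlgebra A]

instance : CoeSort (HilbRep.{u} A) (Type u) := ⟨HilbRep.carrier⟩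

/-- Bounded `A`-module maps between Hilbert spaces carrying representations of `A`. -/
abbrev ModuleMap (K L : HilbRep.{u} A) : Type u :=
  {X : K →L[ℂ] L // ∀ a : A, X ∘L K.rep a = L.rep a ∘L X}

namespace ModuleMap

variable {K L M : HilbRep.{u} A}

/-- Composition of module maps. -/
def comp (Y : ModuleMap L M) (X : ModuleMap K L) : ModuleMap K M :=
  ⟨Y.1 ∘L X.1, fun a => by
    rw [ContinuousLinearMap.comp_assoc, X.2, ← ContinuousLinearMap.comp_assoc, Y.2,
      ContinuousLinearMap.comp_assoc]⟩

/-- The identity module map. -/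
def id (K : HilbRep.{u} A) : ModuleMap K K := ⟨ContinuousLinearMap.id ℂ K, fun a => by ext; rfl⟩

end ModuleMap

variable [PartialOrder A]

section correspondence

variable {E : Type u} [NormedAddCommGroup E] [NormedSpace ℂ E] [CompleteSpace E] [Module A E]
  [Module Aᵐᵒᵖ E] [Correspondence A E]

open Correspondence

local notation "⟪" e ", " f "⟫" => Correspondence.ip (A := A) e f



theorem ip_add_right (e f g : E) : ⟪e, f + g⟫ = ⟪e, f⟫ + ⟪e, g⟫ := by
  rw [← star_ip, ip_add_left, star_add, star_ip, star_ip]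

theorem ip_smul_right (c : ℂ) (e f : E) : ⟪e, c • f⟫ = star c • ⟪e, f⟫ := by
  rw [← star_ip, ip_smul_left, star_smul, star_ip]

theorem ip_op_smul_right (a : A) (e f : E) : ⟪e, MulOpposite.op a • f⟫ = star a * ⟪e, f⟫ := by
  rw [← star_ip, ip_op_smul_left, star_mul, star_ip]

theorem ip_zero_left (f : E) : ⟪0, f⟫ = 0 := by
  simpa using ip_smul_left (A := A) 0 (0 : E) f

theorem ip_zero_right (f : E) : ⟪f, 0⟫ = 0 := by
  simpa using ip_smul_right (A := A) 0 f (0 : E)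

theorem ip_sum_left {ι : Type*} (s : Finset ι) (x : ι → E) (f : E) :
    ⟪∑ i ∈ s, x i, f⟫ = ∑ i ∈ s, ⟪x i, f⟫ := by
  classical
  induction s using Finset.induction_on with
  | empty => simp [ip_zero_left]
  | insert i s hi ih => rw [Finset.sum_insert hi, Finset.sum_insert hi, ip_add_left, ih]

theorem ip_sum_right {ι : Type*} (s : Finset ι) (x : ι → E) (f : E) :
    ⟪f, ∑ i ∈ s, x i⟫ = ∑ i ∈ s, ⟪f, x i⟫ := by
  classical
  induction s using Finset.induction_on with
  | empty => simp [ip_zero_right]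
  | insert i s hi ih => rw [Finset.sum_insert hi, Finset.sum_insert hi, ip_add_right, ih]

variable [StarOrderedRing A]

/-- The Gram matrix of finitely many elements of `E` is of the form `C⋆ C` in `Mₙ(A)`. -/
theorem exists_gram {ι : Type*} [Fintype ι] (e : ι → E) :
    ∃ c : ι → ι → A, ∀ i j, ⟪e j, e i⟫ = ∑ k, star (c k i) * c k j := by
  classical
  let G : CStarMatrix ι ι A := CStarMatrix.ofMatrix fun i j => ⟪e j, e i⟫
  have hG : ∀ i j, G i j = ⟪e j, e i⟫ := fun i j => rfl
  have hsa : IsSelfAdjoint G := by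
    ext i j
    rw [CStarMatrix.star_apply, hG, hG, star_ip]
  obtain ⟨C, D, hPN, hPN0⟩ := exists_jordan G hsa
  set P := star C * C with hP
  set N := star D * D with hD
  have hNsa : star N = N := by rw [hD, star_mul, star_star]
  have h1 : N * G * N = -(star (D * N) * (D * N)) := by
    rw [← hPN, star_mul, hNsa]
    rw [mul_assoc (N : CStarMatrix ι ι A) (star D), ← mul_assoc (star D), ← hD, mul_sub, sub_mul,
      mul_assoc N P, hPN0]
    simp [mul_assoc]
  have h2 : ∀ j, 0 ≤ (N * G * N) j j := by
    intro j
    have : (N * G * N) j j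
        = ⟪∑ l, MulOpposite.op (N l j) • e l, ∑ k, MulOpposite.op (N k j) • e k⟫ := by
      rw [ip_sum_left]
      simp only [ip_sum_right, ip_op_smul_left, ip_op_smul_right]
      rw [CStarMatrix.mul_apply]
      refine Finset.sum_congr rfl fun l _ => ?_
      rw [CStarMatrix.mul_apply, Finset.sum_mul]
      refine Finset.sum_congr rfl fun k _ => ?_
      rw [hG, ← CStarMatrix.star_apply, hNsa, mul_assoc]
    rw [this]
    exact ip_self_nonneg _
  have h3 : D * N = 0 := by
    ext k j
    have h := h2 j
    rw [h1, CStarMatrix.neg_apply, CStarMatrix.mul_apply] at h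
    simp only [CStarMatrix.star_apply] at h
    have h' : ∑ k, star ((D * N) k j) * (D * N) k j = 0 :=
      le_antisymm (by simpa using h) (Finset.sum_nonneg fun k _ => star_mul_self_nonneg _)
    have := (Finset.sum_eq_zero_iff_of_nonneg (fun k _ => star_mul_self_nonneg _)).1 h' k
      (Finset.mem_univ k)
    simpa [CStarRing.star_mul_self_eq_zero_iff] using this
  have h4 : N * N = 0 := by
    conv_lhs => rw [hD]
    rw [mul_assoc, ← hD, h3, mul_zero]
  have h5 : N = 0 := by
    have : star N * N = 0 := by rw [hNsa, h4]
    exact CStarRing.star_mul_self_eq_zero_iff N |>.1 this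
  refine ⟨C, fun i j => ?_⟩
  have hC : G = star C * C := by rw [← hPN, h5, sub_zero]
  rw [← hG, hC, CStarMatrix.mul_apply]
  simp only [CStarMatrix.star_apply]



end correspondence

variable [StarOrderedRing A]

variable (E : Type u) [NormedAddCommGroup E] [NormedSpace ℂ E] [CompleteSpace E] [Module A E]
  [Module Aᵐᵒᵖ E]

/-- The algebraic tensor product of `E` with a Hilbert space carrying a representation of `A`,
before completion; it will carry the semi-inner product of the balanced tensor product. -/
def PreTensor (K : HilbRep.{u} A) : Type u := E ⊗[ℂ] K

variable [Correspondence A E] (K L M : HilbRep.{u} A)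

namespace PreTensor

open Correspondence

instance : AddCommGroup (PreTensor E K) := inferInstanceAs (AddCommGroup (E ⊗[ℂ] K))
instance : Module ℂ (PreTensor E K) := inferInstanceAs (Module ℂ (E ⊗[ℂ] K))

variable {E K} in
/-- The functional `e' ⊗ h' ↦ ⟨⟨e', e⟩ · h', h⟩` (linear in `e' ⊗ h'`). -/
def formRight (e : E) (h : K) : E ⊗[ℂ] K →ₗ[ℂ] ℂ :=
  TensorProduct.lift (LinearMap.mk₂ ℂ
    (fun (e' : E) (h' : K) => inner ℂ h (K.rep (ip e' e) h'))
    (fun _ _ _ => by simp [ip_add_left])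
    (fun _ _ _ => by simp [ip_smul_left])
    (fun _ _ _ => by simp)
    (fun _ _ _ => by simp))

/-- The sesquilinear form on the algebraic tensor product, in Mathlib's convention
(conjugate-linear in the first variable):
`(e ⊗ h, e' ⊗ h') ↦ ⟨⟨e', e⟩ · h', h⟩`, where `⟨·, ·⟩` is linear in the first variable. -/
def form : E ⊗[ℂ] K →ₗ⋆[ℂ] E ⊗[ℂ] K →ₗ[ℂ] ℂ :=
  TensorProduct.lift (LinearMap.mk₂'ₛₗ (starRingEnd ℂ) (starRingEnd ℂ)
    (fun (e : E) (h : K) => formRight e h)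
    (fun e₁ e₂ h => by
      ext e' h'; simp [formRight, ip_add_right])
    (fun c e h => by
      ext e' h'; simp [formRight, ip_smul_right])
    (fun e h₁ h₂ => by
      ext e' h'; simp [formRight])
    (fun c e h => by
      ext e' h'; simp [formRight, mul_comm]))

theorem form_tmul (e e' : E) (h h' : K) :
    form E K (e ⊗ₜ h) (e' ⊗ₜ h') = inner ℂ h (K.rep (ip e' e) h') := rfl

variable {E} in
/-- The form of a sum of elementary tensors, in terms of a factorization of the Gram matrix. -/
theorem form_sum {ι : Type*} [Fintype ι] (e : ι → E) (c : ι → ι → A)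
    (hc : ∀ i j, ip (e j) (e i) = ∑ k, star (c k i) * c k j) (h : ι → K) :
    form E K (∑ i, e i ⊗ₜ h i) (∑ i, e i ⊗ₜ h i)
      = ((∑ k, ‖∑ j, K.rep (c k j) (h j)‖ ^ 2 : ℝ) : ℂ) := by
  have h1 : ∀ k, ((‖∑ j, K.rep (c k j) (h j)‖ ^ 2 : ℝ) : ℂ)
      = ∑ i, ∑ j, inner ℂ (h i) (K.rep (star (c k i) * c k j) (h j)) := by
    intro k
    push_cast
    refine (inner_self_eq_norm_sq_to_K (𝕜 := ℂ) (∑ j, K.rep (c k j) (h j))).symm.trans ?_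
    rw [sum_inner]
    refine Finset.sum_congr rfl fun i _ => ?_
    rw [inner_sum]
    refine Finset.sum_congr rfl fun j _ => ?_
    rw [map_mul, map_star, ContinuousLinearMap.star_eq_adjoint, mul_apply_eq_comp,
      ContinuousLinearMap.adjoint_inner_right]
  rw [Complex.ofReal_sum]
  simp_rw [h1]
  simp only [map_sum, LinearMap.sum_apply, form_tmul, hc, _root_.sum_apply, inner_sum]
  rw [Finset.sum_comm]
  conv_rhs => rw [Finset.sum_comm]
  refine Finset.sum_congr rfl fun i _ => ?_
  rw [Finset.sum_comm]

theorem exists_sum (x : E ⊗[ℂ] K) :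
    ∃ (n : ℕ) (e : Fin n → E) (h : Fin n → K), x = ∑ i, e i ⊗ₜ h i := by
  obtain ⟨n, e, h, hx⟩ := TensorProduct.exists_sum_tmul_eq x
  exact ⟨n, e, h, hx⟩

/-- The semi-inner product of the tensor product: `⟨e ⊗ h, e' ⊗ h'⟩ = ⟨⟨e, e'⟩ · h, h'⟩` for the
inner products that are linear in the first variable. -/
instance core : PreInnerProductSpace.Core ℂ (PreTensor E K) where
  inner x y := form E K x y
  conj_inner_symm x y := by
    change starRingEnd ℂ (form E K y x) = form E K x y
    obtain ⟨n, e, h, rfl⟩ := exists_sum E K x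
    obtain ⟨m, e', h', rfl⟩ := exists_sum E K y
    simp only [map_sum, LinearMap.sum_apply, form_tmul]
    rw [Finset.sum_comm]
    refine Finset.sum_congr rfl fun i _ => Finset.sum_congr rfl fun j _ => ?_
    rw [inner_conj_symm, ← ContinuousLinearMap.adjoint_inner_right,
      ← ContinuousLinearMap.star_eq_adjoint, ← map_star, star_ip]
  re_inner_nonneg x := by
    obtain ⟨n, e, h, rfl⟩ := exists_sum E K x
    obtain ⟨c, hc⟩ := exists_gram (A := A) e
    rw [form_sum K e c hc h]
    simp only [RCLike.re_to_complex, Complex.ofReal_re]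
    positivity
  add_left x y z := LinearMap.map_add₂ (form E K) x y z
  smul_left x y r := LinearMap.map_smulₛₗ₂ (form E K) r x y

instance : SeminormedAddCommGroup (PreTensor E K) :=
  InnerProductSpace.Core.toSeminormedAddCommGroup (𝕜 := ℂ)

instance : InnerProductSpace ℂ (PreTensor E K) := InnerProductSpace.ofCore (core E K)

theorem inner_def (x y : PreTensor E K) : inner ℂ x y = form E K x y := rfl

/-- The identity map from the plain tensor product to `PreTensor E K`. -/
def toPre : E ⊗[ℂ] K ≃ₗ[ℂ] PreTensor E K := LinearEquiv.refl ℂ (E ⊗[ℂ] K)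

theorem norm_sq (x : E ⊗[ℂ] K) : ((‖toPre E K x‖ ^ 2 : ℝ) : ℂ) = form E K x x := by
  push_cast
  exact (inner_self_eq_norm_sq_to_K (𝕜 := ℂ) (toPre E K x)).symm

variable {E K L}

/-- `I ⊗ X` on the algebraic tensor product. -/
def idMap (X : ModuleMap K L) : PreTensor E K →L[ℂ] PreTensor E L :=
  LinearMap.mkContinuous (toPre E L ∘ₗ TensorProduct.map LinearMap.id X.1.toLinearMap ∘ₗ
    (toPre E K).symm.toLinearMap) ‖X.1‖ (by
    intro x
    obtain ⟨x, rfl⟩ := (toPre E K).surjective x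
    obtain ⟨n, e, h, rfl⟩ := exists_sum E K x
    obtain ⟨c, hc⟩ := exists_gram (A := A) e
    refine le_of_sq_le_sq ?_ (by positivity)
    rw [mul_pow]
    have h1 := norm_sq E K (∑ i, e i ⊗ₜ h i)
    have h2 := norm_sq E L (∑ i, e i ⊗ₜ X.1 (h i))
    have h3 : (toPre E L ∘ₗ TensorProduct.map LinearMap.id X.1.toLinearMap ∘ₗ
        (toPre E K).symm.toLinearMap) (toPre E K (∑ i, e i ⊗ₜ[ℂ] h i))
        = toPre E L (∑ i, e i ⊗ₜ[ℂ] X.1 (h i)) := by simp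
    rw [form_sum K e c hc h] at h1
    rw [form_sum L e c hc] at h2
    rw [h3, Complex.ofReal_injective h1, Complex.ofReal_injective h2, Finset.mul_sum]
    refine Finset.sum_le_sum fun k _ => ?_
    have h4 : ∑ j, L.rep (c k j) (X.1 (h j)) = X.1 (∑ j, K.rep (c k j) (h j)) := by
      rw [map_sum]
      refine Finset.sum_congr rfl fun j _ => ?_
      exact (DFunLike.congr_fun (X.2 (c k j)) (h j)).symm
    rw [h4, ← mul_pow]
    gcongr
    exact X.1.le_opNorm _)

variable (E K) in
/-- `φ(a) ⊗ I` on the algebraic tensor product, where `φ(a)` is the left action of `a`. -/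
def leftMulₗ (a : A) : E ⊗[ℂ] K →ₗ[ℂ] E ⊗[ℂ] K :=
  TensorProduct.map
    ({ toFun := fun e => a • e
       map_add' := smul_add a
       map_smul' := fun c e => by
        have h1 := smul_complex (A := A) c (1 : A) (a • e)
        have h2 := smul_complex (A := A) c (1 : A) e
        rw [one_smul] at h1 h2
        rw [RingHom.id_apply, ← h1, ← h2, smul_smul, smul_smul]
        simp } : E →ₗ[ℂ] E) LinearMap.id

theorem leftMulₗ_tmul (a : A) (e : E) (h : K) : leftMulₗ E K a (e ⊗ₜ h) = (a • e) ⊗ₜ h := rfl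

theorem leftMulₗ_mul (a b : A) (x : E ⊗[ℂ] K) :
    leftMulₗ E K (a * b) x = leftMulₗ E K a (leftMulₗ E K b x) := by
  induction x with
  | zero => simp
  | tmul e h => simp only [leftMulₗ_tmul, mul_smul]
  | add x y hx hy => simp only [map_add, hx, hy]

theorem leftMulₗ_add (a b : A) (x : E ⊗[ℂ] K) :
    leftMulₗ E K (a + b) x = leftMulₗ E K a x + leftMulₗ E K b x := by
  induction x with
  | zero => simp
  | tmul e h => simp only [leftMulₗ_tmul, add_smul, TensorProduct.add_tmul]
  | add x y hx hy => simp only [map_add, hx, hy]; abel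

theorem leftMulₗ_algebraMap (c : ℂ) (x : E ⊗[ℂ] K) :
    leftMulₗ E K (algebraMap ℂ A c) x = c • x := by
  induction x with
  | zero => simp
  | tmul e h =>
    rw [leftMulₗ_tmul, Algebra.algebraMap_eq_smul_one, smul_complex, one_smul,
      TensorProduct.smul_tmul']
  | add x y hx hy => simp only [map_add, hx, hy, smul_add]

theorem form_leftMulₗ (a : A) (x y : E ⊗[ℂ] K) :
    form E K x (leftMulₗ E K a y) = form E K (leftMulₗ E K (star a) x) y := by
  induction x with
  | zero => simp
  | add x₁ x₂ h₁ h₂ => simp only [map_add, LinearMap.add_apply, h₁, h₂]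
  | tmul e h =>
    induction y with
    | zero => simp
    | add y₁ y₂ h₁ h₂ => simp only [map_add, h₁, h₂]
    | tmul e' h' => rw [leftMulₗ_tmul, leftMulₗ_tmul, form_tmul, form_tmul, ip_smul_left_eq]

variable (E K) in
/-- `φ(a) ⊗ I` as a bounded operator for the seminorm. -/
def leftMul (a : A) : PreTensor E K →L[ℂ] PreTensor E K :=
  LinearMap.mkContinuous (toPre E K ∘ₗ leftMulₗ E K a ∘ₗ (toPre E K).symm.toLinearMap) ‖a‖ (by
    intro x
    obtain ⟨x, rfl⟩ := (toPre E K).surjective x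
    have h5 : (toPre E K ∘ₗ leftMulₗ E K a ∘ₗ (toPre E K).symm.toLinearMap) (toPre E K x)
      = toPre E K (leftMulₗ E K a x) := by simp
    rw [h5]
    refine le_of_sq_le_sq ?_ (by positivity)
    have h0 : 0 ≤ algebraMap ℝ A (‖a‖ ^ 2) - star a * a :=
      sub_nonneg.2 (CStarAlgebra.star_mul_le_algebraMap_norm_sq)
    obtain ⟨d, hd⟩ := CStarAlgebra.nonneg_iff_eq_star_mul_self.mp h0
    have h1 := norm_sq E K (leftMulₗ E K a x)
    have h2 := norm_sq E K (leftMulₗ E K d x)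
    have h3 := norm_sq E K x
    have h4 : form E K (leftMulₗ E K a x) (leftMulₗ E K a x)
        + form E K (leftMulₗ E K d x) (leftMulₗ E K d x) = ((‖a‖ ^ 2 : ℝ) : ℂ) * form E K x x := by
      rw [form_leftMulₗ a, form_leftMulₗ d, ← leftMulₗ_mul, ← leftMulₗ_mul, ← LinearMap.add_apply,
        ← map_add, ← leftMulₗ_add, ← hd, add_sub_cancel,
        IsScalarTower.algebraMap_apply ℝ ℂ A, leftMulₗ_algebraMap]
      simp
    rw [← h1, ← h2, ← h3] at h4
    norm_cast at h4
    rw [mul_pow, ← h4]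
    exact le_add_of_nonneg_right (by positivity))

variable (K) in
/-- The elementary tensor `e ⊗ h`, as a continuous linear map in `h`. -/
def creation (e : E) : K →L[ℂ] PreTensor E K :=
  LinearMap.mkContinuous (toPre E K ∘ₗ TensorProduct.mk ℂ E K e) ‖e‖ (by
    intro h
    refine le_of_sq_le_sq ?_ (by positivity)
    change ‖toPre E K (e ⊗ₜ h)‖ ^ 2 ≤ _
    have h1 := norm_sq E K (e ⊗ₜ h)
    rw [form_tmul] at h1
    have h2 : ‖toPre E K (e ⊗ₜ h)‖ ^ 2 = ‖inner ℂ h (K.rep (ip e e : A) h)‖ := by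
      rw [← h1, Complex.norm_real, Real.norm_of_nonneg (by positivity)]
    rw [h2]
    calc ‖inner ℂ h (K.rep (ip e e : A) h)‖ ≤ ‖h‖ * ‖K.rep (ip e e : A) h‖ := norm_inner_le_norm _ _
      _ ≤ ‖h‖ * (‖(ip e e : A)‖ * ‖h‖) := by
        gcongr
        refine (ContinuousLinearMap.le_opNorm _ _).trans ?_
        gcongr
        exact NonUnitalStarAlgHom.norm_apply_le K.rep _
      _ = (‖e‖ * ‖h‖) ^ 2 := by rw [← norm_sq_eq]; ring)

end PreTensor


theorem completion_ext {X Y : Type*} [SeminormedAddCommGroup X] [NormedSpace ℂ X]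
    [NormedAddCommGroup Y] [NormedSpace ℂ Y] {f g : UniformSpace.Completion X →L[ℂ] Y}
    (h : ∀ x : X, f (x : UniformSpace.Completion X) = g (x : UniformSpace.Completion X)) :
    f = g := by
  ext x
  exact UniformSpace.Completion.induction_on x (isClosed_eq f.continuous g.continuous) h

/-- The tensor product `E ⊗_A K`: the Hausdorff completion of the algebraic tensor product for
the semi-inner product `⟨e ⊗ h, e' ⊗ h'⟩ = ⟨⟨e, e'⟩ · h, h'⟩`, with the left action `φ(a) ⊗ I`.
The balancing relation holds in it, see `tmul_balanced`. -/
def tensor : HilbRep.{u} A where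
  carrier := UniformSpace.Completion (PreTensor E K)
  rep :=
    { toFun := fun a => (PreTensor.leftMul E K a).completion
      map_one' := completion_ext fun x => by
        rw [ContinuousLinearMap.completion_apply_coe]
        change ((PreTensor.toPre E K (PreTensor.leftMulₗ E K 1 ((PreTensor.toPre E K).symm x)) :
          PreTensor E K) : UniformSpace.Completion (PreTensor E K)) = x
        rw [← map_one (algebraMap ℂ A), PreTensor.leftMulₗ_algebraMap, one_smul,
          LinearEquiv.apply_symm_apply]
      map_mul' := fun a b => completion_ext fun x => by
        rw [mul_apply_eq_comp, ContinuousLinearMap.completion_apply_coe,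
          ContinuousLinearMap.completion_apply_coe, ContinuousLinearMap.completion_apply_coe]
        exact congrArg _ (PreTensor.leftMulₗ_mul a b ((PreTensor.toPre E K).symm x))
      map_zero' := completion_ext fun x => by
        rw [ContinuousLinearMap.completion_apply_coe]
        change ((PreTensor.toPre E K (PreTensor.leftMulₗ E K 0 ((PreTensor.toPre E K).symm x)) :
          PreTensor E K) : UniformSpace.Completion (PreTensor E K)) = 0
        rw [← map_zero (algebraMap ℂ A), PreTensor.leftMulₗ_algebraMap, zero_smul, map_zero,
          UniformSpace.Completion.coe_zero]
      map_add' := fun a b => completion_ext fun x => by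
        rw [_root_.add_apply, ContinuousLinearMap.completion_apply_coe,
          ContinuousLinearMap.completion_apply_coe, ContinuousLinearMap.completion_apply_coe,
          ← UniformSpace.Completion.coe_add]
        exact congrArg _ (PreTensor.leftMulₗ_add a b ((PreTensor.toPre E K).symm x))
      commutes' := fun c => completion_ext fun x => by
        rw [ContinuousLinearMap.completion_apply_coe, Algebra.algebraMap_eq_smul_one (A := _ →L[ℂ] _),
          _root_.smul_apply, one_apply_eq_self, ← UniformSpace.Completion.coe_smul]
        exact congrArg _ (PreTensor.leftMulₗ_algebraMap c ((PreTensor.toPre E K).symm x))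
      map_star' := fun a => by
        rw [ContinuousLinearMap.star_eq_adjoint, ContinuousLinearMap.eq_adjoint_iff]
        intro x y
        refine UniformSpace.Completion.induction_on₂ x y
          (isClosed_eq (by fun_prop) (by fun_prop)) fun x y => ?_
        rw [ContinuousLinearMap.completion_apply_coe, ContinuousLinearMap.completion_apply_coe,
          UniformSpace.Completion.inner_coe, UniformSpace.Completion.inner_coe]
        exact (PreTensor.form_leftMulₗ a ((PreTensor.toPre E K).symm x)
          ((PreTensor.toPre E K).symm y)).symm }

variable {K} in
/-- The elementary tensor `e ⊗ h`, linear and continuous in `h`. -/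
def tmul (e : E) : K →L[ℂ] tensor E K :=
  UniformSpace.Completion.toComplL ∘L PreTensor.creation K e

variable {E K} in
theorem inner_tmul (e e' : E) (h h' : K) :
    inner ℂ (tmul E e h) (tmul E e' h') = inner ℂ h (K.rep (Correspondence.ip e' e) h') :=
  UniformSpace.Completion.inner_coe (𝕜 := ℂ) _ _

variable {E K} in
theorem rep_tmul (a : A) (e : E) (h : K) :
    (tensor E K).rep a (tmul E e h) = tmul E (a • e) h :=
  ContinuousLinearMap.completion_apply_coe _ _

variable {E K} in
/-- The balancing relation `(e · a) ⊗ h = e ⊗ (a · h)`. -/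
theorem tmul_balanced (a : A) (e : E) (h : K) :
    tmul E (MulOpposite.op a • e) h = tmul E e (K.rep a h) := by
  rw [← sub_eq_zero, ← inner_self_eq_zero (𝕜 := ℂ)]
  simp only [inner_sub_left, inner_sub_right, inner_tmul, Correspondence.ip_op_smul_left,
    ip_op_smul_right, map_mul, map_star, mul_apply_eq_comp,
    ContinuousLinearMap.star_eq_adjoint, ContinuousLinearMap.adjoint_inner_right]
  ring

variable {K L} in
/-- The operator `I_E ⊗ X` for a bounded `A`-module map `X`. -/
def idTensor (X : ModuleMap K L) : ModuleMap (tensor E K) (tensor E L) :=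
  ⟨(PreTensor.idMap X).completion, fun a => completion_ext fun x => by
    change (PreTensor.idMap X).completion ((PreTensor.leftMul E K a).completion x)
      = (PreTensor.leftMul E L a).completion ((PreTensor.idMap X).completion x)
    rw [ContinuousLinearMap.completion_apply_coe, ContinuousLinearMap.completion_apply_coe,
      ContinuousLinearMap.completion_apply_coe, ContinuousLinearMap.completion_apply_coe]
    refine congrArg _ ?_
    obtain ⟨x, rfl⟩ := (PreTensor.toPre E K).surjective x
    change TensorProduct.map LinearMap.id X.1.toLinearMap (PreTensor.leftMulₗ E K a x)
      = PreTensor.leftMulₗ E L a (TensorProduct.map LinearMap.id X.1.toLinearMap x)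
    induction x with
    | zero => simp
    | add x y hx hy => simp only [map_add, hx, hy]
    | tmul e h => rfl⟩

variable {E K L} in
theorem idTensor_tmul (X : ModuleMap K L) (e : E) (h : K) :
    (idTensor E X).1 (tmul E e h) = tmul E e (X.1 h) :=
  ContinuousLinearMap.completion_apply_coe _ _

variable {K L} in
theorem norm_idTensor_le (X : ModuleMap K L) : ‖(idTensor E X).1‖ ≤ ‖X.1‖ := by
  refine ContinuousLinearMap.opNorm_le_bound _ (norm_nonneg _) fun x => ?_
  refine UniformSpace.Completion.induction_on x
    (isClosed_le (by fun_prop) (by fun_prop)) fun x => ?_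
  change ‖(PreTensor.idMap (E := E) X).completion
    (x : UniformSpace.Completion (PreTensor E K))‖ ≤ _
  rw [ContinuousLinearMap.completion_apply_coe]
  refine (UniformSpace.Completion.norm_coe _).le.trans ?_
  refine le_trans ?_ (mul_le_mul_of_nonneg_left
    (UniformSpace.Completion.norm_coe x).ge (norm_nonneg _))
  exact (ContinuousLinearMap.le_opNorm _ x).trans
    (mul_le_mul_of_nonneg_right (LinearMap.mkContinuous_norm_le _ (norm_nonneg _) _)
      (norm_nonneg _))

theorem norm_tmul_le (e : E) (h : K) : ‖tmul E e h‖ ≤ ‖e‖ * ‖h‖ := by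
  refine (UniformSpace.Completion.norm_coe _).le.trans ?_
  exact (ContinuousLinearMap.le_opNorm _ h).trans
    (mul_le_mul_of_nonneg_right (LinearMap.mkContinuous_norm_le _ (norm_nonneg _) _)
      (norm_nonneg _))

/-- `E^{⊗ n} ⊗ K`, with `E^{⊗ n} ⊗ K = E ⊗ (E^{⊗ (n - 1)} ⊗ K)` and `E^{⊗ 0} ⊗ K = A ⊗ K = K`. -/
def tensorPow : ℕ → HilbRep.{u} A
  | 0 => K
  | n + 1 => tensor E (tensorPow n)

variable {K L} in
/-- The operator `I_{E^{⊗ n}} ⊗ X` for a bounded `A`-module map `X`. -/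
def idTensorPow (X : ModuleMap K L) : ∀ n, ModuleMap (tensorPow E K n) (tensorPow E L n)
  | 0 => X
  | n + 1 => idTensor E (idTensorPow X n)

variable {K} in
/-- The generalized power `η ^ n : E^{⊗ n} ⊗ K → K`, given by `η ^ 0 = I` and
`η ^ (n + 1) = η (I_E ⊗ η ^ n)`, i.e. `η ^ n = η (I_E ⊗ η) ⋯ (I_{E^{⊗ (n - 1)}} ⊗ η)`. -/
def genPow (η : ModuleMap (tensor E K) K) : ∀ n, ModuleMap (tensorPow E K n) K
  | 0 => ModuleMap.id K
  | n + 1 => η.comp (idTensor E (genPow η n))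

theorem norm_idTensorPow_le {K L : HilbRep.{u} A} (X : ModuleMap K L) (n : ℕ) :
    ‖(idTensorPow E X n).1‖ ≤ ‖X.1‖ := by
  induction n with
  | zero => exact le_rfl
  | succ n ih => exact (norm_idTensor_le E _).trans ih

variable {K} in
theorem norm_genPow_le (η : ModuleMap (tensor E K) K) (n : ℕ) :
    ‖(genPow E η n).1‖ ≤ ‖η.1‖ ^ n := by
  induction n with
  | zero =>
    change ‖ContinuousLinearMap.id ℂ K‖ ≤ ‖η.1‖ ^ 0
    rw [pow_zero]
    exact ContinuousLinearMap.norm_id_le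
  | succ n ih =>
    refine (ContinuousLinearMap.opNorm_comp_le _ _).trans ?_
    rw [pow_succ']
    gcongr
    exact (norm_idTensor_le E _).trans ih

/-- The Hilbert space `F²(E, σ) = ⊕ₙ E^{⊗ n} ⊗_σ K`. -/
abbrev Fock : Type u := lp (fun n : ℕ => tensorPow E K n) 2

/-- The operator `φ_{∞,σ}(a) = diag(σ(a), φ(a) ⊗ I, …)` on `F²(E, σ)`. -/
def fockRep (a : A) : Fock E K →L[ℂ] Fock E K :=
  lp.mapCLM 2 (fun n => (tensorPow E K n).rep a) (norm_nonneg a)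
    (fun _ => NonUnitalStarAlgHom.norm_apply_le _ a)

variable {E} in
/-- The sequence `(0, ξ ⊗ f₀, ξ ⊗ f₁, …)`. -/
def shiftSeq (ξ : E) (f : ∀ n : ℕ, tensorPow E K n) : ∀ n : ℕ, tensorPow E K n
  | 0 => 0
  | n + 1 => tmul E ξ (f n)

variable {E K} in
theorem shiftSeq_summable (ξ : E) (f : Fock E K) :
    Summable (fun n => ‖shiftSeq K ξ f n‖ ^ (2 : ℝ)) ∧
      ∑' n, ‖shiftSeq K ξ f n‖ ^ (2 : ℝ) ≤ (‖ξ‖ * ‖f‖) ^ (2 : ℝ) := by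
  have h2 : (0 : ℝ) < (2 : ENNReal).toReal := by norm_num
  have hf := (lp.hasSum_norm h2 f).mul_left (‖ξ‖ ^ (2 : ℝ))
  have e2 : (2 : ENNReal).toReal = 2 := by norm_num
  rw [e2] at hf
  have hle : ∀ n, ‖shiftSeq K ξ f (n + 1)‖ ^ (2 : ℝ) ≤ ‖ξ‖ ^ (2 : ℝ) * ‖f n‖ ^ (2 : ℝ) := by
    intro n
    rw [← Real.mul_rpow (norm_nonneg _) (norm_nonneg _)]
    exact Real.rpow_le_rpow (norm_nonneg _) (norm_tmul_le E _ ξ (f n)) (by norm_num)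
  have hs : Summable (fun n => ‖shiftSeq K ξ f (n + 1)‖ ^ (2 : ℝ)) :=
    Summable.of_nonneg_of_le (fun n => by positivity) hle hf.summable
  have hs' : Summable (fun n => ‖shiftSeq K ξ f n‖ ^ (2 : ℝ)) :=
    (summable_nat_add_iff (f := fun n => ‖shiftSeq K ξ f n‖ ^ (2 : ℝ)) 1).1 hs
  refine ⟨hs', ?_⟩
  rw [hs'.tsum_eq_zero_add, Real.mul_rpow (norm_nonneg _) (norm_nonneg _)]
  have h0 : ‖shiftSeq K ξ f 0‖ ^ (2 : ℝ) = 0 := by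
    change ‖(0 : tensorPow E K 0)‖ ^ (2 : ℝ) = 0
    simp
  rw [h0, zero_add]
  exact (hs.tsum_le_tsum hle hf.summable).trans hf.tsum_eq.le

variable {E K} in
theorem norm_le_of_eq_shiftSeq (ξ : E) (f g : Fock E K) (hg : ∀ n, g n = shiftSeq K ξ f n) :
    ‖g‖ ≤ ‖ξ‖ * ‖f‖ := by
  have h2 : (0 : ℝ) < (2 : ENNReal).toReal := by norm_num
  have h := lp.norm_rpow_eq_tsum h2 g
  simp only [hg, ENNReal.toReal_ofNat] at h
  refine (Real.rpow_le_rpow_iff (norm_nonneg _) (by positivity) (z := 2) (by norm_num)).1 ?_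
  exact h.le.trans (shiftSeq_summable ξ f).2

variable {E} in
/-- The creation operator `T_{ξ,σ} : (f₀, f₁, …) ↦ (0, ξ ⊗ f₀, ξ ⊗ f₁, …)` on `F²(E, σ)`. -/
def fockCreation (ξ : E) : Fock E K →L[ℂ] Fock E K :=
  LinearMap.mkContinuous
    { toFun := fun f => ⟨shiftSeq K ξ f, by
        refine memℓp_gen ?_
        simpa using (shiftSeq_summable ξ f).1⟩
      map_add' := fun f g => by
        ext n
        cases n with
        | zero => exact (add_zero (0 : tensorPow E K 0)).symm
        | succ n => exact map_add (tmul E ξ) (f n) (g n)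
      map_smul' := fun c f => by
        ext n
        cases n with
        | zero => exact (smul_zero (A := tensorPow E K 0) c).symm
        | succ n => exact map_smul (tmul E ξ) c (f n) } ‖ξ‖ (by
    intro f
    exact norm_le_of_eq_shiftSeq ξ f _ fun n => rfl)

section ultraweak

variable (H : Type*) [NormedAddCommGroup H] [InnerProductSpace ℂ H]

/-- The weak-⋆ (ultraweak) topology of `L(H)`: the coarsest topology for which all the functionals
`T ↦ ∑ₙ ⟨T xₙ, yₙ⟩` with `∑ ‖xₙ‖² < ∞` and `∑ ‖yₙ‖² < ∞` are continuous. -/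
abbrev ultraweakTopology : TopologicalSpace (H →L[ℂ] H) :=
  ⨅ (x : lp (fun _ : ℕ => H) 2) (y : lp (fun _ : ℕ => H) 2),
    TopologicalSpace.induced (fun T => ∑' n, inner ℂ (y n) (T (x n))) inferInstance

end ultraweak

/-- The analytic Toeplitz algebra `F^∞(E, σ)`: the weak-⋆ closed algebra generated by the operators
`φ_{∞,σ}(a)` (`a ∈ A`) and `T_{ξ,σ}` (`ξ ∈ E`), i.e. the smallest weak-⋆ closed subalgebra of
`L(F²(E, σ))` containing them. -/
def toeplitzAlgebra : Subalgebra ℂ (Fock E K →L[ℂ] Fock E K) :=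
  sInf {B | IsClosed[ultraweakTopology (Fock E K)] (B : Set (Fock E K →L[ℂ] Fock E K)) ∧
    (∀ a : A, fockRep E K a ∈ B) ∧ ∀ ξ : E, fockCreation K ξ ∈ B}

/-- The set `E^σ` of the bounded operators `μ : K → E ⊗_σ K` with `μ σ(a) = (φ(a) ⊗ I) μ`. -/
def intertwiners : Set (K →L[ℂ] tensor E K) :=
  {μ | ∀ a : A, μ ∘L K.rep a = (tensor E K).rep a ∘L μ}

/-- The set `(E^σ)^*` of the operators `η : E ⊗_σ K → K` with `η^* ∈ E^σ`. -/
def dualIntertwiners : Set (tensor E K →L[ℂ] K) :=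
  {η | ContinuousLinearMap.adjoint η ∈ intertwiners E K}

/-- The open unit disc `𝔻((E^σ)^*)`. -/
def disc : Set (tensor E K →L[ℂ] K) := {η | η ∈ dualIntertwiners E K ∧ ‖η‖ < 1}

/-- The commutant `σ(A)'`. -/
def commutant : Set (K →L[ℂ] K) := {b | ∀ a : A, b ∘L K.rep a = K.rep a ∘L b}

variable {E K}

/-- The elements of `(E^σ)^*` are `A`-module maps. -/
theorem dualIntertwiners_moduleMap {η : tensor E K →L[ℂ] K} (hη : η ∈ dualIntertwiners E K)
    (a : A) : η ∘L (tensor E K).rep a = K.rep a ∘L η := by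
  have h := congrArg ContinuousLinearMap.adjoint (hη (star a))
  simp only [ContinuousLinearMap.adjoint_comp, ContinuousLinearMap.adjoint_adjoint, map_star,
    ContinuousLinearMap.star_eq_adjoint] at h
  exact h.symm

/-- An element of the disc as a bounded `A`-module map. -/
def disc.toModuleMap (η : disc E K) : ModuleMap (tensor E K) K :=
  ⟨η.1, dualIntertwiners_moduleMap η.2.1⟩

/-- An element of the commutant as a bounded `A`-module map. -/
def commutant.toModuleMap (b : commutant K) : ModuleMap K K := ⟨b.1, b.2⟩

/-- The `n`-th term `η ^ n (I_{E^{⊗ n}} ⊗ b) f_n` of the point evaluation. -/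
def pointTerm (η : disc E K) (b : commutant K) (f : Fock E K) (n : ℕ) : K :=
  (genPow E (disc.toModuleMap η) n).1 ((idTensorPow E (commutant.toModuleMap b) n).1 (f n))

theorem norm_pointTerm_le (η : disc E K) (b : commutant K) (f : Fock E K) (n : ℕ) :
    ‖pointTerm η b f n‖ ≤ ‖η.1‖ ^ n * (‖b.1‖ * ‖f‖) := by
  refine (ContinuousLinearMap.le_opNorm _ _).trans ?_
  refine mul_le_mul (norm_genPow_le E _ n) ?_ (norm_nonneg _) (by positivity)
  refine (ContinuousLinearMap.le_opNorm _ _).trans ?_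
  exact mul_le_mul (norm_idTensorPow_le E _ n) (lp.norm_apply_le_norm (by norm_num) f n)
    (norm_nonneg _) (norm_nonneg _)

theorem summable_pointTerm (η : disc E K) (b : commutant K) (f : Fock E K) :
    Summable (pointTerm η b f) :=
  Summable.of_norm_bounded
    ((summable_geometric_of_lt_one (norm_nonneg _) η.2.2).mul_right _) (norm_pointTerm_le η b f)

/-- The point evaluation `f ↦ f^∧(η, b) = ∑ₙ η ^ n (I_{E^{⊗ n}} ⊗ b) f_n`, a bounded operator from
`F²(E, σ)` to the representation space. -/
def pointEval (η : disc E K) (b : commutant K) : Fock E K →L[ℂ] K :=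
  LinearMap.mkContinuous
    { toFun := fun f => ∑' n, pointTerm η b f n
      map_add' := fun f g => by
        rw [← (summable_pointTerm η b f).tsum_add (summable_pointTerm η b g)]
        exact tsum_congr fun n => by simp [pointTerm]
      map_smul' := fun c f => by
        rw [← (summable_pointTerm η b f).tsum_const_smul]
        exact tsum_congr fun n => by simp [pointTerm] } ((1 - ‖η.1‖)⁻¹ * ‖b.1‖) (by
    intro f
    refine tsum_of_norm_bounded ?_ (norm_pointTerm_le η b f)
    rw [mul_assoc]
    exact (hasSum_geometric_of_lt_one (norm_nonneg _) η.2.2).mul_right _)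

theorem pointEval_apply (η : disc E K) (b : commutant K) (f : Fock E K) :
    pointEval η b f = ∑' n, pointTerm η b f n := rfl

/-- The identity operator, as an element of the commutant. -/
def commutant.one : commutant K := ⟨ContinuousLinearMap.id ℂ K, fun _ => rfl⟩

/-- The embedding of `K` into `F²(E, σ)` as the summand of index `0`. -/
def vacuum : K →L[ℂ] Fock E K :=
  lp.singleContinuousLinearMap ℂ (fun n : ℕ => tensorPow E K n) 2 0

/-- The operator `R^∧(η) ∈ L(K)`, `R^∧(η) e = (R e)^∧(η, I)`. -/
def operatorEval (R : Fock E K →L[ℂ] Fock E K) (η : disc E K) : K →L[ℂ] K :=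
  pointEval η commutant.one ∘L R ∘L vacuum

end Toeplitz

end

/-! Both statements come from one identity, `(Rf)^∧(η,b) = R^∧(η) f^∧(η,b)`. Let `evalAlgebra` be
the set of all bounded `R` that satisfy it for every `η`, `b` and `f`. It suffices that this set is
an algebra, contains the generators and is weak-* closed, because `toeplitzAlgebra` is the smallest
such algebra.

The generators are handled by hand. Evaluation turns `φ_{∞,σ}(a)` into `σ(a)`, because `η^n` and `I
⊗ b` are module maps (`pointEval_fockRep`). It turns `T_ξ` into `e ↦ η(ξ ⊗ e)`, because `η^{n+1} =
η(I ⊗ η^n)` (`pointEval_fockCreation`). By `pointEval_vacuum`, these operators on `σ`'s space are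
exactly the symbols of the generators.

Closedness needs only matrix coefficients. Point evaluation is bounded, so it can be moved to the
other side of an inner product as an adjoint. The identity then compares two functionals `R ↦ ⟨R v,
u⟩`, which are weak-* continuous (`isClosed_evalAlgebra`).

The symbol of `R` is defined by evaluation at `b = I`. Closure under products therefore uses the
identity at `I` as well as at `b`, which is why all `b` are treated together. -/

namespace Toeplitz

/-! ### Matrix coefficients in the weak-* topology -/

section ultraweak

variable {H : Type*} [NormedAddCommGroup H] [InnerProductSpace ℂ H]

/-- Matrix coefficients are continuous for the ultraweak topology. -/
theorem continuous_ultraweak_inner (u v : H) :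
    Continuous[ultraweakTopology H, inferInstance] fun T : H →L[ℂ] H => inner ℂ u (T v) := by
  -- Sequences supported at index 0 are square-summable, and for them the defining series `∑ ⟨T xₙ,
  -- yₙ⟩` has a single term.
  have h := continuous_iff_le_induced.2
    (iInf₂_le (lp.single 2 (0 : ℕ) v) (lp.single 2 (0 : ℕ) u) :
      ultraweakTopology H ≤ _)
  convert h using 1
  funext T
  rw [tsum_eq_single 0]
  · simp
  · intro n hn
    simp [lp.single_apply, Pi.single_eq_of_ne hn]

end ultraweak

/-! ### Point evaluation on vacuum vectors and on the generators -/

variable {A : Type v} [CStarAlgebra A] [PartialOrder A] [StarOrderedRing A]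
  {E : Type u} [NormedAddCommGroup E] [NormedSpace ℂ E] [CompleteSpace E] [Module A E]
  [Module Aᵐᵒᵖ E] [Correspondence A E] {K : HilbRep.{u} A}

theorem vacuum_apply_zero (e : K) : (vacuum (E := E) e : Fock E K) 0 = e :=
  lp.single_apply_self (E := fun n : ℕ => tensorPow E K n) 2 0 e

theorem vacuum_apply_succ (e : K) (n : ℕ) : (vacuum (E := E) e : Fock E K) (n + 1) = 0 :=
  lp.single_apply_ne (E := fun n : ℕ => tensorPow E K n) 2 0 e n.succ_ne_zero

/-- Only the term of degree 0 survives, where `η^0 = I` and `I_{E^{⊗0}} ⊗ b` is `b`. At `b = I` this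
is what identifies the symbols of the generators and of the scalars. -/
theorem pointEval_vacuum (η : disc E K) (b : commutant K) (e : K) :
    pointEval η b (vacuum e) = b.1 e := by
  rw [pointEval_apply, tsum_eq_single 0]
  · change b.1 ((vacuum (E := E) e : Fock E K) 0) = b.1 e
    rw [vacuum_apply_zero]
  · intro n hn
    obtain ⟨m, rfl⟩ := Nat.exists_eq_succ_of_ne_zero hn
    rw [pointTerm, Nat.succ_eq_add_one, vacuum_apply_succ, map_zero, map_zero]

/-- Degree by degree, `a` passes first through `I ⊗ b` and then through `η^n`. This is where the
commutant condition on `b` and the intertwining condition on `η` enter. -/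
theorem pointEval_fockRep (η : disc E K) (b : commutant K) (a : A) (f : Fock E K) :
    pointEval η b (fockRep E K a f) = K.rep a (pointEval η b f) := by
  rw [pointEval_apply, pointEval_apply, (K.rep a).map_tsum (summable_pointTerm η b f)]
  refine tsum_congr fun n => ?_
  change (genPow E (disc.toModuleMap η) n).1 ((idTensorPow E (commutant.toModuleMap b) n).1
    ((tensorPow E K n).rep a (f n))) = _
  have h₁ := DFunLike.congr_fun ((idTensorPow E (commutant.toModuleMap b) n).2 a) (f n)
  have h₂ := DFunLike.congr_fun ((genPow E (disc.toModuleMap η) n).2 a)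
    ((idTensorPow E (commutant.toModuleMap b) n).1 (f n))
  simp only [ContinuousLinearMap.comp_apply] at h₁ h₂
  rw [h₁, h₂, pointTerm]

/-- Creation adds a tensor factor on the left, and the recursions for `η^{n+1}` and `I_{E^{⊗n+1}} ⊗
b` peel off that same factor. The term of degree `n+1` is thus `η(ξ ⊗ ·)` applied to the old term of
degree `n`, and this bounded map can be taken out of the convergent sum. -/
theorem pointEval_fockCreation (η : disc E K) (b : commutant K) (ξ : E) (f : Fock E K) :
    pointEval η b (fockCreation K ξ f) = η.1 (tmul E ξ (pointEval η b f)) := by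
  rw [pointEval_apply, pointEval_apply, (tmul E ξ).map_tsum (summable_pointTerm η b f),
    η.1.map_tsum ((tmul E ξ).summable (summable_pointTerm η b f)),
    (summable_pointTerm η b _).tsum_eq_zero_add]
  -- A created vector has no component of degree 0, so the remaining terms are indexed by `n + 1`.
  have h₀ : pointTerm η b (fockCreation K ξ f) 0 = 0 := by
    change b.1 (0 : K) = 0
    exact map_zero _
  rw [h₀, zero_add]
  refine tsum_congr fun n => ?_
  change η.1 ((idTensor E (genPow E (disc.toModuleMap η) n)).1
    ((idTensor E (idTensorPow E (commutant.toModuleMap b) n)).1 (tmul E ξ (f n)))) = _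
  rw [idTensor_tmul, idTensor_tmul, pointTerm]

theorem operatorEval_apply (R : Fock E K →L[ℂ] Fock E K) (η : disc E K) (e : K) :
    operatorEval R η e = pointEval η commutant.one (R (vacuum e)) := rfl

/-! ### The algebra of operators compatible with evaluation -/

variable (E K) in
/-- The algebra of the operators that all point evaluations intertwine with their symbols. -/
def evalAlgebra : Subalgebra ℂ (Fock E K →L[ℂ] Fock E K) where
  carrier := {R | ∀ (η : disc E K) (b : commutant K) (f : Fock E K),
    pointEval η b (R f) = operatorEval R η (pointEval η b f)}
  mul_mem' {R S} hR hS η b f := by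
    -- With `x = f^∧(η,b)`, the left side becomes `R^∧(η) S^∧(η) x`. On the right, the identity for
    -- `R` is used at `b = I` on the vector `S x`, with `x` placed in degree 0.
    rw [operatorEval_apply, mul_apply_eq_comp, mul_apply_eq_comp, hR, hS, hR η commutant.one,
      operatorEval_apply S]
  add_mem' {R S} hR hS η b f := by
    rw [operatorEval_apply, _root_.add_apply, _root_.add_apply, map_add, map_add, hR, hS,
      operatorEval_apply, operatorEval_apply]
  algebraMap_mem' c η b f := by
    rw [operatorEval_apply, Algebra.algebraMap_eq_smul_one, _root_.smul_apply, _root_.smul_apply,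
      one_apply_eq_self, one_apply_eq_self, map_smul, map_smul, pointEval_vacuum]
    rfl

theorem mem_evalAlgebra {R : Fock E K →L[ℂ] Fock E K} :
    R ∈ evalAlgebra E K ↔ ∀ (η : disc E K) (b : commutant K) (f : Fock E K),
      pointEval η b (R f) = operatorEval R η (pointEval η b f) := Iff.rfl

theorem fockRep_mem_evalAlgebra (a : A) : fockRep E K a ∈ evalAlgebra E K := by
  intro η b f
  rw [operatorEval_apply, pointEval_fockRep, pointEval_fockRep, pointEval_vacuum]
  rfl

theorem fockCreation_mem_evalAlgebra (ξ : E) : fockCreation K ξ ∈ evalAlgebra E K := by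
  intro η b f
  rw [operatorEval_apply, pointEval_fockCreation, pointEval_fockCreation, pointEval_vacuum]
  rfl

/-- For fixed `η`, `b`, `f` the vector `f^∧(η,b)` does not depend on `R`, so both sides of the
identity are bounded operators applied to `R` at a fixed vector. Testing against every `y` and
taking adjoints gives an intersection of equalizers of matrix coefficients. -/
theorem isClosed_evalAlgebra :
    IsClosed[ultraweakTopology (Fock E K)]
      (evalAlgebra E K : Set (Fock E K →L[ℂ] Fock E K)) := by
  have h : (evalAlgebra E K : Set (Fock E K →L[ℂ] Fock E K))
      = ⋂ (η : disc E K) (b : commutant K) (f : Fock E K) (y : K),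
        {R | inner ℂ (ContinuousLinearMap.adjoint (pointEval η b) y) (R f)
          = inner ℂ (ContinuousLinearMap.adjoint (pointEval η commutant.one) y)
            (R (vacuum (pointEval η b f)))} := by
    ext R
    simp only [SetLike.mem_coe, mem_evalAlgebra, Set.mem_iInter, Set.mem_ofPred_eq,
      ContinuousLinearMap.adjoint_inner_left, ← operatorEval_apply]
    exact forall₃_congr fun η b f => ⟨fun h y => by rw [h], fun h => ext_inner_left ℂ h⟩
  rw [h]
  -- Closedness below refers to the weak-* topology, not to the norm topology.
  let _ : TopologicalSpace (Fock E K →L[ℂ] Fock E K) := ultraweakTopology (Fock E K)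
  exact isClosed_iInter fun _ => isClosed_iInter fun _ => isClosed_iInter fun _ =>
    isClosed_iInter fun _ =>
      isClosed_eq (continuous_ultraweak_inner _ _) (continuous_ultraweak_inner _ _)

theorem toeplitzAlgebra_le_evalAlgebra : toeplitzAlgebra E K ≤ evalAlgebra E K :=
  sInf_le ⟨isClosed_evalAlgebra, fockRep_mem_evalAlgebra, fockCreation_mem_evalAlgebra⟩

end Toeplitz

theorem proposition4p4 {A : Type v} [CStarAlgebra A] [PartialOrder A] [StarOrderedRing A]
    {E : Type u} [NormedAddCommGroup E] [NormedSpace ℂ E] [CompleteSpace E] [Module A E]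
    [Module Aᵐᵒᵖ E] [Toeplitz.Correspondence A E] (σ : Toeplitz.HilbRep.{u} A) :
    (∀ R ∈ Toeplitz.toeplitzAlgebra E σ, ∀ S ∈ Toeplitz.toeplitzAlgebra E σ,
      ∀ η : Toeplitz.disc E σ,
        Toeplitz.operatorEval (R * S) η = Toeplitz.operatorEval R η * Toeplitz.operatorEval S η) ∧
    (∀ R ∈ Toeplitz.toeplitzAlgebra E σ, ∀ f : Toeplitz.Fock E σ,
      ∀ (η : Toeplitz.disc E σ) (b : Toeplitz.commutant σ),
        Toeplitz.pointEval η b (R f) = Toeplitz.operatorEval R η (Toeplitz.pointEval η b f)) := by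
  have h := Toeplitz.toeplitzAlgebra_le_evalAlgebra (E := E) (K := σ)
  refine ⟨fun R hR S _ η => ?_, fun R hR f η b => h hR η b f⟩
  ext e
  -- Multiplicativity is the identity for `R` at `b = I` and `f = S e`.
  rw [Toeplitz.operatorEval_apply, mul_apply_eq_comp, mul_apply_eq_comp, h hR,
    Toeplitz.operatorEval_apply S]
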